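/- Let $\mathbb{K}$ be an algebraically closed field of characteristic $\neq 2$, and let $A$ and $B$ be skew-symmetric bilinear forms on a finite-dimensional vector space $V$ over $\mathbb{K}$. Then there is a basis of $V$ in which the matrices of both forms are block-diagonal with blocks of the same sizes, $A=\operatorname{diag}(A_1,\dots,A_m)$ and $B=\operatorname{diag}(B_1,\dots,B_m)$, and for each $i$ $$A_i=\begin{pmatrix}0&M_i\\-M_i^{T}&0\end{pmatrix},\qquad B_i=\begin{pmatrix}0&N_i\\-N_i^{T}&0\end{pmatrix},$$ where the pair $(M_i,N_i)$ is one of the following. Here $I_n$ is the $n\times n$ identity matrix, and $J_n(\lambda)$ is the $n\times n$ matrix with $\lambda$ on the diagonal, $1$ on the first superdiagonal and $0$ elsewhere. 1. (Jordan block with eigenvalue $\lambda\in\mathbb{K}$) $M_i=J_n(\lambda)$ and $N_i=I_n$, for some $n\ge 1$. 2. (Jordan block with eigenvalue $\infty$) $M_i=I_n$ and $N_i=J_n(0)$, for some $n\ge 1$. 3. (Kronecker block) $M_i=(I_k\mid 0)$ and $N_i=(0\mid I_k)$ are $k\times(k+1)$ matrices, for some $k\ge 0$, where $0$ is a zero column;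 thus $A_i$ and $B_i$ are $(2k+1)\times(2k+1)$ matrices, and for $k=0$ both are the $1\times 1$ zero matrix. The values of $n$, $k$ and $\lambda$ may depend on $i$. -/

import Mathlib

/-- The kinds of blocks in the Jordan–Kronecker form of a pair of skew-symmetric forms over `K`:
a `2n × 2n` Jordan block (`n ≥ 1`) with eigenvalue `lam ∈ K`, a `2n × 2n` Jordan block (`n ≥ 1`)
with eigenvalue `∞`, and a `(2k+1) × (2k+1)` Kronecker block (`k ≥ 0`). -/
inductive JKBlock (K : Type*) where
  | jordan (n : ℕ) (hn : 1 ≤ n) (lam : K)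
  | jordanInfty (n : ℕ) (hn : 1 ≤ n)
  | kronecker (k : ℕ)

namespace JKBlock

/-- The number of rows of the upper right corner of a block. -/
def rows {K : Type*} : JKBlock K → ℕ
  | jordan n _ _ => n
  | jordanInfty n _ => n
  | kronecker k => k

/-- The number of columns of the upper right corner of a block. -/
def cols {K : Type*} : JKBlock K → ℕ
  | jordan n _ _ => n
  | jordanInfty n _ => n
  | kronecker k => k + 1

/-- The row and column indices of a block. -/
abbrev Index {K : Type*} (b : JKBlock K) : Type := Fin b.rows ⊕ Fin b.cols

/-- The `p × q` matrix with `a` on the main diagonal, `c` on the first superdiagonal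
and zeros elsewhere. -/
def bidiagonal {K : Type*} [Zero K] (p q : ℕ) (a c : K) : Matrix (Fin p) (Fin q) K :=
  Matrix.of fun i j =>
    if (i : ℕ) = (j : ℕ) then a else if (i : ℕ) + 1 = (j : ℕ) then c else 0

/-- The upper right corner of the block of the first form. -/
def cornerA {K : Type*} [Field K] : (b : JKBlock K) → Matrix (Fin b.rows) (Fin b.cols) K
  | jordan n _ lam => bidiagonal n n lam 1
  | jordanInfty n _ => bidiagonal n n 1 0
  | kronecker k => bidiagonal k (k + 1) 1 0

/-- The upper right corner of the block of the second form. -/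
def cornerB {K : Type*} [Field K] : (b : JKBlock K) → Matrix (Fin b.rows) (Fin b.cols) K
  | jordan n _ _ => bidiagonal n n 1 0
  | jordanInfty n _ => bidiagonal n n 0 1
  | kronecker k => bidiagonal k (k + 1) 0 1

/-- The block of the first form: zero diagonal corners, upper right corner `C`,
lower left corner `-Cᵀ`. -/
def matA {K : Type*} [Field K] (b : JKBlock K) : Matrix b.Index b.Index K :=
  Matrix.fromBlocks 0 b.cornerA (-b.cornerA.transpose) 0

/-- The block of the second form: zero diagonal corners, upper right corner `C`,
lower left corner `-Cᵀ`. -/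
def matB {K : Type*} [Field K] (b : JKBlock K) : Matrix b.Index b.Index K :=
  Matrix.fromBlocks 0 b.cornerB (-b.cornerB.transpose) 0

end JKBlock

/-! ### Chains of vectors, duality and Gram matrices -/

section Chains

variable {K : Type*} [Field K] {V : Type*} [AddCommGroup V] [Module K V]

open LinearMap (BilinForm)

/-! By induction on dim V it suffices to split off one block, orthogonally for both forms.

Suppose `B` is degenerate. Take vectors with B q_0 = 0 and A q_j = B q_{j+1}: a nonzero polynomial
solution of least degree if one exists (Kronecker block), otherwise a longest chain (eigenvalue ∞).
The q_j are mutually orthogonal for both forms (`chain_isotropic`), and a sequence p with B p_i = A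
p_{i+1} and A(p_0, q_j) = δ_{0j} completes them to the block (`chain_pairing`).

The admissible p_0 form a subspace `chainStart`. If none has the prescribed pairings, some
combination of the A q_j involving A q_0 vanishes on it. A functional vanishing there is B z_0 for a
chain z, and this z yields a longer chain or a solution of smaller degree, a contradiction.

If `B` is nondegenerate, an eigenvector of B⁻¹A for λ lies in the kernel of A - λB, and the ∞ case
for the pair (B, A - λB) gives the block of J_n(λ). -/

/-- The vectors `p 0` starting a sequence with `B (p i) = A (p (i + 1))` for `i < m`
and `p m ∈ T`. -/
def chainStart (A B : BilinForm K V) (T : Submodule K V) : ℕ → Submodule K V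
  | 0 => T
  | m + 1 => ((chainStart A B T m).map A).comap B

theorem exists_chain_of_mem_chainStart {A B : BilinForm K V} {T : Submodule K V} (m : ℕ) {v : V}
    (hv : v ∈ chainStart A B T m) :
    ∃ p : ℕ → V, p 0 = v ∧ (∀ i < m, B (p i) = A (p (i + 1))) ∧ p m ∈ T := by
  induction m generalizing v with
  | zero => exact ⟨fun _ => v, rfl, by simp, hv⟩
  | succ m ih =>
    obtain ⟨w, hw, hwv⟩ := hv
    obtain ⟨p, hp0, hp, hpm⟩ := ih hw
    refine ⟨fun i => Nat.casesOn i v p, rfl, ?_, hpm⟩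
    rintro (_ | i) hi
    · simpa [hp0] using hwv.symm
    · exact hp i (by omega)

/-- A functional vanishing on the preimage of `U` under an alternating form `B` is `B z` for
some `z` annihilated by `U`. -/
theorem exists_eq_of_vanishing_on_comap [FiniteDimensional K V] {B : BilinForm K V}
    (hB : B.IsAlt) (U : Submodule K (Module.Dual K V)) (φ : Module.Dual K V)
    (h : ∀ v ∈ U.comap B, φ v = 0) : ∃ z, φ = B z ∧ ∀ u ∈ U, u z = 0 := by
  have hφ : φ ∈ LinearMap.range (LinearMap.dualMap (U.mkQ ∘ₗ B)) := by
    rw [LinearMap.range_dualMap_eq_dualAnnihilator_ker, Submodule.mem_dualAnnihilator]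
    intro v hv
    exact h v (by simpa using hv)
  obtain ⟨g, rfl⟩ := hφ
  obtain ⟨z, hz⟩ := (Module.evalEquiv K V).surjective (g ∘ₗ U.mkQ)
  have hz' : ∀ u, u z = g (U.mkQ u) := fun u => LinearMap.congr_fun hz u
  -- The sign comes from moving z from the second slot of `B` to the first.
  refine ⟨-z, ?_, fun u hu => ?_⟩
  · ext v
    have := hz' (B v)
    rw [← hB.neg_eq v (-z)]
    simp [this]
  · rw [map_neg, hz', Submodule.mkQ_apply, (Submodule.Quotient.mk_eq_zero U).2 hu]
    simp

/-- One application of `exists_eq_of_vanishing_on_comap` gives φ = B z_0 with z_0 annihilated by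
A(chainStart m); by antisymmetry A z_0 vanishes on chainStart m, so the argument repeats. -/
theorem exists_chain_of_vanishing_on_chainStart_bot [FiniteDimensional K V] {A B : BilinForm K V}
    (hA : A.IsAlt) (hB : B.IsAlt) (m : ℕ) (φ : Module.Dual K V)
    (h : ∀ v ∈ chainStart A B ⊥ (m + 1), φ v = 0) :
    ∃ z : ℕ → V, φ = B (z 0) ∧ ∀ i < m, A (z i) = B (z (i + 1)) := by
  induction m generalizing φ with
  | zero =>
    obtain ⟨z, hz, -⟩ := exists_eq_of_vanishing_on_comap hB _ φ h
    exact ⟨fun _ => z, hz, by simp⟩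
  | succ m ih =>
    obtain ⟨z, hz, hU⟩ := exists_eq_of_vanishing_on_comap hB _ φ h
    obtain ⟨y, hy0, hy⟩ := ih (A z) fun v hv => by
      rw [← hA.neg_eq, hU _ (Submodule.mem_map_of_mem hv), neg_zero]
    refine ⟨fun i => Nat.casesOn i z y, hz, ?_⟩
    rintro (_ | i) hi
    · exact hy0
    · exact hy i (by omega)

theorem exists_chain_of_vanishing_on_chainStart_top [FiniteDimensional K V] {A B : BilinForm K V}
    (hA : A.IsAlt) (hB : B.IsAlt) (m : ℕ) (φ : Module.Dual K V)
    (h : ∀ v ∈ chainStart A B ⊤ m, φ v = 0) :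
    ∃ z : ℕ → V, φ = B (z 0) ∧ (∀ i, A (z i) = B (z (i + 1))) ∧ ∀ i, m ≤ i → z i = 0 := by
  induction m generalizing φ with
  | zero =>
    refine ⟨fun _ => 0, ?_, by simp, by simp⟩
    ext v
    simpa using h v trivial
  | succ m ih =>
    obtain ⟨z, hz, hU⟩ := exists_eq_of_vanishing_on_comap hB _ φ h
    obtain ⟨y, hy0, hy, hym⟩ := ih (A z) fun v hv => by
      rw [← hA.neg_eq, hU _ (Submodule.mem_map_of_mem hv), neg_zero]
    refine ⟨fun i => Nat.casesOn i z y, hz, ?_, ?_⟩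
    · rintro (_ | i)
      · exact hy0
      · exact hy i
    · rintro (_ | i) hi
      · omega
      · exact hym i (by omega)

/-- Either some vector of `S` has first coordinate `1` and the other coordinates `0` under the
functionals `f 0, …, f (n - 1)`, or a combination involving `f 0` vanishes on `S`. -/
theorem exists_dual_vector_or_relation (S : Submodule K V) (n : ℕ) (f : ℕ → Module.Dual K V) :
    (∃ v ∈ S, ∀ j < n, f j v = if j = 0 then 1 else 0) ∨
    ∃ μ : ℕ → K, μ 0 ≠ 0 ∧
      ∀ v ∈ S, (∑ j ∈ Finset.range n, μ j • f j) v = 0 := by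
  let F : V →ₗ[K] (Fin n → K) := LinearMap.pi fun j => f j
  let d : Fin n → K := fun j => if (j : ℕ) = 0 then 1 else 0
  by_cases hd : d ∈ S.map F
  · obtain ⟨v, hv, hvd⟩ := hd
    exact Or.inl ⟨v, hv, fun j hj => congr_fun hvd ⟨j, hj⟩⟩
  · obtain ⟨g, hg, hS⟩ := Submodule.exists_le_ker_of_notMem hd
    have hgs : ∀ x : Fin n → K, g x = ∑ j, x j * g (Pi.single j 1) := fun x => by
      rw [g.pi_apply_eq_sum_univ]
      refine Finset.sum_congr rfl fun j _ => ?_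
      rw [smul_eq_mul]
      congr 2
      ext i
      simp [Pi.single_apply, eq_comm]
    have hn : 0 < n := by
      rcases Nat.eq_zero_or_pos n with rfl | h
      · exact absurd (by rw [Subsingleton.elim d 0, map_zero]) hg
      · exact h
    have h0 : g (Pi.single ⟨0, hn⟩ 1) ≠ 0 := by
      convert hg using 2
      ext i
      simp [d, Pi.single_apply, Fin.ext_iff]
    let μ : ℕ → K := fun j => if h : j < n then g (Pi.single ⟨j, h⟩ 1) else 0
    have hμ0 : μ 0 ≠ 0 := by simpa [μ, hn] using h0
    refine Or.inr ⟨μ, hμ0, fun v hv => ?_⟩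
    have := hS (Submodule.mem_map_of_mem hv)
    rw [LinearMap.mem_ker, hgs] at this
    rw [Finset.sum_range, LinearMap.sum_apply]
    rw [← this]
    refine Finset.sum_congr rfl fun j _ => ?_
    simp [μ, F, mul_comm]

/-- The members of a chain are orthogonal to each other for both forms. -/
theorem chain_isotropic {A B : BilinForm K V} (hA : A.IsAlt) (hB : B.IsAlt) {n : ℕ} {z : ℕ → V}
    (hz : ∀ j, j + 1 < n → A (z j) = B (z (j + 1))) {i j : ℕ} (hi : i < n) (hj : j < n) :
    A (z i) (z j) = 0 ∧ B (z i) (z j) = 0 := by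
  -- Using the chain relation at both ends moves the indices towards each other, so the gap d drops
  -- by 2; gaps 0 and 1 vanish because both forms are alternating.
  have key : ∀ d i, i + d < n → A (z i) (z (i + d)) = 0 := by
    intro d
    induction d using Nat.twoStepInduction with
    | zero => intro i _; exact hA.self_eq_zero _
    | one =>
      intro i h
      rw [hz i h]
      exact hB.self_eq_zero _
    | more d ih _ =>
      intro i h
      rw [hz i (by omega), ← hB.neg_eq, show i + (d + 2) = i + 1 + d + 1 by omega,
        ← hz _ (by omega), hA.neg_eq, ih (i + 1) (by omega)]
  have hAz : ∀ i j, i < n → j < n → A (z i) (z j) = 0 := by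
    intro i j hi hj
    rcases le_total i j with h | h
    · obtain ⟨d, rfl⟩ := Nat.exists_eq_add_of_le h
      exact key d i hj
    · obtain ⟨d, rfl⟩ := Nat.exists_eq_add_of_le h
      rw [← hA.neg_eq, key d j hi, neg_zero]
  refine ⟨hAz i j hi hj, ?_⟩
  rcases i with _ | i
  · rcases j with _ | j
    · exact hB.self_eq_zero _
    · rw [← hB.neg_eq, ← hz j hj, hAz _ _ (by omega) hi, neg_zero]
  · rw [← hz i hi, hAz _ _ (by omega) hj]

/-- The two chain relations give A(p_{i+1}, q_{j+1}) = B(p_i, q_{j+1}) = A(p_i, q_j), so the values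
at p_0, together with B q_0 = 0, determine all the others. -/
theorem chain_pairing {A B : BilinForm K V} (hA : A.IsAlt) (hB : B.IsAlt) {a b : ℕ} {p q : ℕ → V}
    (hq0 : B (q 0) = 0) (hq : ∀ j, j + 1 < b → A (q j) = B (q (j + 1)))
    (hp : ∀ i, i + 1 < a → B (p i) = A (p (i + 1)))
    (h0 : ∀ j < b, A (p 0) (q j) = if j = 0 then 1 else 0) {i j : ℕ} (hi : i < a) (hj : j < b) :
    A (p i) (q j) = (if i = j then 1 else 0) ∧ B (p i) (q j) = if i + 1 = j then 1 else 0 := by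
  have hBq : ∀ v, B v (q 0) = 0 := fun v => by rw [← hB.neg_eq, hq0]; simp
  have key : ∀ i j, i < a → j < b → A (p i) (q j) = if i = j then 1 else 0 := by
    intro i
    induction i with
    | zero => intro j _ hj; simpa [eq_comm] using h0 j hj
    | succ i ih =>
      rintro (_ | j) hi hj
      · rw [← hp i hi, hBq]; simp
      · rw [← hp i hi, ← hB.neg_eq, ← hq j hj, hA.neg_eq, ih j (by omega) (by omega)]
        simp
  refine ⟨key i j hi hj, ?_⟩
  rcases j with _ | j
  · rw [hBq]; simp
  · rw [← hB.neg_eq, ← hq j hj, hA.neg_eq, key i j hi (by omega)]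
    simp

/-- The vectors `p 0, …, p (a - 1), q 0, …, q (b - 1)`. -/
def pairFamily (p q : ℕ → V) (a b : ℕ) : Fin a ⊕ Fin b → V :=
  Sum.elim (fun i => p i) (fun j => q j)

theorem pairFamily_gram {A B : BilinForm K V} (hA : A.IsAlt) (hB : B.IsAlt) {a b : ℕ} {p q : ℕ → V}
    (hq0 : B (q 0) = 0) (hq : ∀ j, j + 1 < b → A (q j) = B (q (j + 1)))
    (hp : ∀ i, i + 1 < a → B (p i) = A (p (i + 1)))
    (h0 : ∀ j < b, A (p 0) (q j) = if j = 0 then 1 else 0) (x y : Fin a ⊕ Fin b) :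
    A (pairFamily p q a b x) (pairFamily p q a b y) =
      Matrix.fromBlocks 0 (JKBlock.bidiagonal a b (1 : K) 0)
        (-(JKBlock.bidiagonal a b (1 : K) 0).transpose) 0 x y ∧
    B (pairFamily p q a b x) (pairFamily p q a b y) =
      Matrix.fromBlocks 0 (JKBlock.bidiagonal a b (0 : K) 1)
        (-(JKBlock.bidiagonal a b (0 : K) 1).transpose) 0 x y := by
  have hpq := fun (i : Fin a) (j : Fin b) => chain_pairing hA hB hq0 hq hp h0 i.2 j.2
  have e : ∀ i j : ℕ, (if i = j then (0 : K) else if i + 1 = j then 1 else 0) =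
      if i + 1 = j then 1 else 0 := by
    intro i j; split_ifs <;> first | rfl | omega
  rcases x with i | i <;> rcases y with j | j
  · exact (chain_isotropic hB hA hp i.2 j.2).symm
  · simp [pairFamily, JKBlock.bidiagonal, hpq, e]
  · simp only [pairFamily, Sum.elim_inl, Sum.elim_inr, Matrix.fromBlocks_apply₂₁]
    rw [← hA.neg_eq, ← hB.neg_eq (p j)]
    simp [JKBlock.bidiagonal, hpq, e]
  · exact chain_isotropic hA hB hq i.2 j.2

end Chains

/-! ### Splitting off a block from a longest chain or a minimal solution -/

section Blocks

variable {K : Type*} [Field K] {V : Type*} [AddCommGroup V] [Module K V]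

open LinearMap (BilinForm)

/-- A chain of length `n` starting at a nonzero vector of the kernel of `B`. -/
def IsJordanChain (A B : BilinForm K V) (n : ℕ) (q : ℕ → V) : Prop :=
  q 0 ≠ 0 ∧ B (q 0) = 0 ∧ ∀ j, j + 1 < n → A (q j) = B (q (j + 1))

/-- The coefficients of a polynomial solution, of degree at most `k`, of the pencil `A`, `B`. -/
def IsNullChain (A B : BilinForm K V) (k : ℕ) (q : ℕ → V) : Prop :=
  B (q 0) = 0 ∧ (∀ j, A (q j) = B (q (j + 1))) ∧ ∀ j, k < j → q j = 0

/-- The vectors `e`, with coordinate functionals `ξ`, span an orthogonal summand of the pair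
`(A, B)` on which the forms have the matrices `MA` and `MB`. -/
structure SplitsPair {ι : Type*} [DecidableEq ι] (A B : BilinForm K V) (MA MB : Matrix ι ι K)
    (e : ι → V) (ξ : ι → Module.Dual K V) : Prop where
  dual : ∀ x y, ξ x (e y) = if x = y then 1 else 0
  gramA : ∀ x y, A (e x) (e y) = MA x y
  gramB : ∀ x y, B (e x) (e y) = MB x y
  orth : ∀ w, (∀ x, ξ x w = 0) → ∀ x, A w (e x) = 0 ∧ B w (e x) = 0

/-- If no polynomial solution exists, the vectors of a chain are linearly independent. -/
theorem IsJordanChain.coeff_eq_zero {A B : BilinForm K V}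
    (hnull : ∀ k q, IsNullChain A B k q → q = 0) {n : ℕ} {q : ℕ → V}
    (hq : IsJordanChain A B n q) {N : ℕ} (hN : N ≤ n) (c : ℕ → K) (z : ℕ → V)
    (hz : ∀ i, A (z i) = B (z (i + 1))) (k : ℕ) (hk : ∀ i, k < i → z i = 0)
    (h : ∑ j ∈ Finset.range N, c j • q j = z 0) : ∀ j < N, c j = 0 := by
  induction N generalizing c z k with
  | zero => simp
  | succ N ih =>
    obtain ⟨hq0, hBq0, hqs⟩ := hq
    rw [Finset.sum_range_succ'] at h
    have h' : A (∑ j ∈ Finset.range N, c (j + 1) • q j) = B (z 0) := by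
      rw [← h, map_add, map_sum, map_sum, map_smul, hBq0, smul_zero, add_zero]
      refine Finset.sum_congr rfl fun j hj => ?_
      rw [Finset.mem_range] at hj
      rw [map_smul, map_smul, hqs j (by omega)]
    have hc : ∀ j < N, c (j + 1) = 0 := by
      -- Prepending the shifted combination to z trades one term of the sum for one more term of z;
      -- this is why the statement allows a general z.
      refine ih (by omega) (fun j => c (j + 1))
        (fun i => Nat.casesOn i (∑ j ∈ Finset.range N, c (j + 1) • q j) z) ?_ (k + 1) ?_ rfl
      · rintro (_ | i)
        · exact h'
        · exact hz i
      · rintro (_ | i) hi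
        · omega
        · exact hk i (by omega)
    rw [Finset.sum_eq_zero fun j hj => by rw [hc j (Finset.mem_range.1 hj), zero_smul],
      zero_add] at h
    have hz0 : z = 0 := hnull k z ⟨by rw [← h, map_smul, hBq0, smul_zero], hz, hk⟩
    rintro (_ | j) hj
    · rw [hz0] at h
      exact (smul_eq_zero.1 h).resolve_right hq0
    · exact hc j (by omega)

theorem IsJordanChain.length_le_finrank [FiniteDimensional K V] {A B : BilinForm K V}
    (hnull : ∀ k q, IsNullChain A B k q → q = 0) {n : ℕ} {q : ℕ → V}
    (hq : IsJordanChain A B n q) : n ≤ Module.finrank K V := by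
  have hli : LinearIndependent K fun j : Fin n => q j := by
    rw [Fintype.linearIndependent_iff]
    intro g hg j
    have := hq.coeff_eq_zero hnull le_rfl (fun j => if h : j < n then g ⟨j, h⟩ else 0)
      0 (by simp) 0 (by simp) (by rw [Finset.sum_range]; simpa using hg) j j.2
    simpa using this
  simpa using hli.fintype_card_le_finrank

/-- A combination of the vectors of a longest chain cannot be continued to a chain of the same
length. -/
theorem IsJordanChain.coeff_eq_zero_of_extension {A B : BilinForm K V} {n : ℕ} {q : ℕ → V}
    (hq : IsJordanChain A B n q) (hmax : ∀ q', ¬ IsJordanChain A B (n + 1) q') {N : ℕ}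
    (hN : N ≤ n) (c : ℕ → K) (z : ℕ → V) (hz : ∀ i, i + 1 < n → A (z i) = B (z (i + 1)))
    (h : A (∑ j ∈ Finset.range N, c j • q j) = B (z 0)) : ∀ j < N, c j = 0 := by
  induction N generalizing c z with
  | zero => simp
  | succ N ih =>
    have ⟨hq0, hBq0, hqs⟩ := hq
    rw [Finset.sum_range_succ'] at h
    have hc : ∀ j < N, c (j + 1) = 0 := by
      refine ih (by omega) (fun j => c (j + 1)) (fun i => Nat.casesOn i
        (∑ j ∈ Finset.range N, c (j + 1) • q (j + 1) + c 0 • q 0) z) ?_ ?_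
      · rintro (_ | i) hi
        · exact h
        · exact hz i (by omega)
      · change A _ = B (∑ j ∈ Finset.range N, c (j + 1) • q (j + 1) + c 0 • q 0)
        simp only [map_add, map_sum, map_smul, hBq0, smul_zero, add_zero]
        refine Finset.sum_congr rfl fun j hj => ?_
        rw [Finset.mem_range] at hj
        rw [hqs j (by omega)]
    rw [Finset.sum_eq_zero fun j hj => by rw [hc j (Finset.mem_range.1 hj), zero_smul],
      zero_add] at h
    rintro (_ | j) hj
    · by_contra hc0
      -- Only c_0 q_0 is left, and followed by z it is a chain of length n + 1.
      refine hmax (fun i => Nat.casesOn i (c 0 • q 0) z)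
        ⟨smul_ne_zero hc0 hq0, by simp [hBq0], ?_⟩
      rintro (_ | i) hi
      · exact h
      · exact hz i (by omega)
    · exact hc j (by omega)

theorem IsJordanChain.exists_splitsPair [FiniteDimensional K V] {A B : BilinForm K V}
    (hA : A.IsAlt) (hB : B.IsAlt) {n : ℕ} {q : ℕ → V} (hn : 1 ≤ n)
    (hq : IsJordanChain A B n q) (hmax : ∀ q', ¬ IsJordanChain A B (n + 1) q') :
    ∃ (e : Fin n ⊕ Fin n → V) (ξ : Fin n ⊕ Fin n → Module.Dual K V),
      SplitsPair A B
        (Matrix.fromBlocks 0 (JKBlock.bidiagonal n n (1 : K) 0)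
          (-(JKBlock.bidiagonal n n (1 : K) 0).transpose) 0)
        (Matrix.fromBlocks 0 (JKBlock.bidiagonal n n (0 : K) 1)
          (-(JKBlock.bidiagonal n n (0 : K) 1).transpose) 0) e ξ := by
  obtain ⟨m, rfl⟩ := Nat.exists_eq_add_of_le' hn
  have ⟨hq0, hBq0, hqs⟩ := hq
  -- Requiring p_{m+1} = 0 gives B p_m = 0, so no functional beyond the A p_i and A q_j is needed
  -- for orthogonality to the complement.
  rcases exists_dual_vector_or_relation (chainStart A B ⊥ (m + 1)) (m + 1)
      (fun j => -A (q j)) with ⟨v, hv, hvq⟩ | ⟨μ, hμ0, hμ⟩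
  · obtain ⟨p, rfl, hp, hpm⟩ := exists_chain_of_mem_chainStart _ hv
    rw [Submodule.mem_bot] at hpm
    have h0 : ∀ j < m + 1, A (p 0) (q j) = if j = 0 then 1 else 0 := fun j hj => by
      rw [← hvq j hj, ← hA.neg_eq]; simp
    have hp' : ∀ i, i + 1 < m + 1 → B (p i) = A (p (i + 1)) := fun i hi => hp i (by omega)
    have hpair := fun (i j : Fin (m + 1)) => chain_pairing hA hB hBq0 hqs hp' h0 i.2 j.2
    refine ⟨pairFamily p q (m + 1) (m + 1),
      Sum.elim (fun i => -A (q i)) (fun j => A (p j)), ?_,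
      fun x y => (pairFamily_gram hA hB hBq0 hqs hp' h0 x y).1,
      fun x y => (pairFamily_gram hA hB hBq0 hqs hp' h0 x y).2, ?_⟩
    · rintro (i | i) (j | j)
      · simp [pairFamily, hA.neg_eq, hpair, Fin.ext_iff, eq_comm]
      · simp [pairFamily, (chain_isotropic hA hB hqs i.2 j.2).1]
      · simp [pairFamily, (chain_isotropic hB hA hp' i.2 j.2).2]
      · simp [pairFamily, hpair, Fin.ext_iff]
    · intro w hw
      have hwq : ∀ j, j < m + 1 → A (q j) w = 0 := fun j hj => by
        simpa using hw (Sum.inl ⟨j, hj⟩)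
      have hwp : ∀ i, i < m + 1 → A (p i) w = 0 := fun i hi => hw (Sum.inr ⟨i, hi⟩)
      rintro (⟨i, hi⟩ | ⟨j, hj⟩) <;> simp only [pairFamily, Sum.elim_inl, Sum.elim_inr]
      · refine ⟨by rw [← hA.neg_eq, hwp i hi, neg_zero], ?_⟩
        rw [← hB.neg_eq, hp i hi, neg_eq_zero]
        rcases Nat.lt_or_eq_of_le (Nat.succ_le_of_lt hi) with h | h
        · exact hwp _ h
        · rw [show i + 1 = m + 1 from h, hpm]; simp
      · refine ⟨by rw [← hA.neg_eq, hwq j hj, neg_zero], ?_⟩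
        rw [← hB.neg_eq, neg_eq_zero]
        rcases j with _ | j
        · rw [hBq0]; simp
        · rw [← hqs j hj, hwq j (by omega)]
  · obtain ⟨z, hz0, hz⟩ := exists_chain_of_vanishing_on_chainStart_bot hA hB m _ hμ
    refine absurd (hq.coeff_eq_zero_of_extension hmax le_rfl μ (fun i => -z i) ?_ ?_ 0 hn) hμ0
    · intro i hi
      simp [hz i (by omega)]
    · rw [map_neg, ← hz0]
      simp

theorem IsNullChain.exists_splitsPair [FiniteDimensional K V] {A B : BilinForm K V}
    (hA : A.IsAlt) (hB : B.IsAlt) {k : ℕ} {q : ℕ → V} (hq : IsNullChain A B k q) (hne : q ≠ 0)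
    (hmin : ∀ k' < k, ∀ q', IsNullChain A B k' q' → q' = 0) :
    ∃ (e : Fin k ⊕ Fin (k + 1) → V) (ξ : Fin k ⊕ Fin (k + 1) → Module.Dual K V),
      SplitsPair A B
        (Matrix.fromBlocks 0 (JKBlock.bidiagonal k (k + 1) (1 : K) 0)
          (-(JKBlock.bidiagonal k (k + 1) (1 : K) 0).transpose) 0)
        (Matrix.fromBlocks 0 (JKBlock.bidiagonal k (k + 1) (0 : K) 1)
          (-(JKBlock.bidiagonal k (k + 1) (0 : K) 1).transpose) 0) e ξ := by
  have ⟨hBq0, hqs, hqk⟩ := hq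
  have hqs' : ∀ j, j + 1 < k + 1 → A (q j) = B (q (j + 1)) := fun j _ => hqs j
  have hAqk : A (q k) = 0 := by rw [hqs, hqk _ (by omega), map_zero]
  rcases k with _ | k
  · have hq0 : q 0 ∉ (⊥ : Submodule K V) := by
      rw [Submodule.mem_bot]
      intro h
      refine hne (funext fun j => ?_)
      rcases j with _ | j
      · exact h
      · exact hqk _ (by omega)
    obtain ⟨f, -, hf⟩ := LinearMap.exists_extend_of_notMem (K := K) 0 hq0 (1 : K)
    refine ⟨fun _ => q 0, fun _ => f, ?_, ?_, ?_, ?_⟩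
    · rintro (i | i) (j | j)
      · exact i.elim0
      · exact i.elim0
      · exact j.elim0
      · simp [hf, Subsingleton.elim (α := Fin 1) i j]
    · rintro (i | i) (j | j)
      · exact i.elim0
      · exact i.elim0
      · exact j.elim0
      · simp [hAqk]
    · rintro (i | i) (j | j)
      · exact i.elim0
      · exact i.elim0
      · exact j.elim0
      · simp [hBq0]
    · intro w _ _
      rw [← hA.neg_eq, ← hB.neg_eq, hAqk, hBq0]
      simp
  -- The end of p is free here, and q_{k+1} needs no condition because A q_{k+1} = 0. Its coordinate
  -- functional below is B p_k.
  · rcases exists_dual_vector_or_relation (chainStart A B ⊤ k) (k + 1)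
        (fun j => -A (q j)) with ⟨v, hv, hvq⟩ | ⟨μ, hμ0, hμ⟩
    · obtain ⟨p, rfl, hp, -⟩ := exists_chain_of_mem_chainStart _ hv
      have h0 : ∀ j < k + 1 + 1, A (p 0) (q j) = if j = 0 then 1 else 0 := fun j hj => by
        rcases Nat.lt_or_eq_of_le (Nat.le_of_lt_succ hj) with h | rfl
        · rw [← hvq j h, ← hA.neg_eq]; simp
        · rw [← hA.neg_eq, hAqk]; simp
      have hp' : ∀ i, i + 1 < k + 1 → B (p i) = A (p (i + 1)) := fun i hi => hp i (by omega)
      have hpair := fun i j hi hj => chain_pairing hA hB hBq0 hqs' hp' h0 (i := i) (j := j) hi hj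
      have hpp := fun i j hi hj => chain_isotropic hB hA hp' (i := i) (j := j) hi hj
      refine ⟨pairFamily p q (k + 1) (k + 1 + 1),
        Sum.elim (fun i => -A (q i)) (fun j => if (j : ℕ) < k + 1 then A (p j) else B (p k)), ?_,
        fun x y => (pairFamily_gram hA hB hBq0 hqs' hp' h0 x y).1,
        fun x y => (pairFamily_gram hA hB hBq0 hqs' hp' h0 x y).2, ?_⟩
      · rintro (i | i) (j | j)
        · simp [pairFamily, hA.neg_eq, hpair j i j.2 (by omega), Fin.ext_iff, eq_comm]
        · simp [pairFamily, (chain_isotropic hA hB hqs' (i := i) (by omega) j.2).1]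
        · simp only [pairFamily, Sum.elim_inl, Sum.elim_inr, reduceCtorEq, if_false]
          split_ifs with h
          · exact (hpp i j h j.2).2
          · exact (hpp k j (by omega) j.2).1
        · simp only [pairFamily, Sum.elim_inr, Sum.inr.injEq, Fin.ext_iff]
          split_ifs with h h' h'
          · rw [(hpair i j h j.2).1, if_pos h']
          · rw [(hpair i j h j.2).1, if_neg h']
          · rw [(hpair k j (by omega) j.2).2, if_pos (by omega)]
          · rw [(hpair k j (by omega) j.2).2, if_neg (by omega)]
      · intro w hw
        have hwq : ∀ j, j < k + 1 → A (q j) w = 0 := fun j hj => by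
          simpa using hw (Sum.inl ⟨j, hj⟩)
        have hwp : ∀ i, i < k + 1 → A (p i) w = 0 := fun i hi => by
          simpa [Nat.le_of_lt_succ hi] using hw (Sum.inr ⟨i, by omega⟩)
        have hwk : B (p k) w = 0 := by
          simpa using hw (Sum.inr ⟨k + 1, by omega⟩)
        rintro (⟨i, hi⟩ | ⟨j, hj⟩) <;> simp only [pairFamily, Sum.elim_inl, Sum.elim_inr]
        · refine ⟨by rw [← hA.neg_eq, hwp i hi, neg_zero], ?_⟩
          rw [← hB.neg_eq, neg_eq_zero]
          rcases Nat.lt_or_eq_of_le (Nat.le_of_lt_succ hi) with h | rfl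
          · rw [hp i h, hwp _ (by omega)]
          · exact hwk
        · constructor
          · rw [← hA.neg_eq, neg_eq_zero]
            rcases Nat.lt_or_eq_of_le (Nat.le_of_lt_succ hj) with h | rfl
            · exact hwq j h
            · rw [hAqk]; simp
          · rw [← hB.neg_eq, neg_eq_zero]
            rcases j with _ | j
            · rw [hBq0]; simp
            · rw [← hqs j, hwq j (by omega)]
    · obtain ⟨z, hz0, hz, hzk⟩ := exists_chain_of_vanishing_on_chainStart_top hA hB k _ hμ
      -- This is z plus a μ-combination of shifts of q, a solution of degree at most k, hence zero.
      -- Its coefficient at k is μ_0 q_{k+1}, so q itself would have degree at most k.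
      have hx := hmin k (by omega)
        (fun m => z m + ∑ j ∈ Finset.range (k + 1), μ j • q (j + m + 1)) ⟨?_, ?_, ?_⟩
      · have := congr_fun hx k
        simp only [hzk k le_rfl, zero_add, Pi.zero_apply] at this
        rw [Finset.sum_range_succ', Finset.sum_eq_zero fun j _ => by
          rw [hqk _ (by omega), smul_zero], zero_add, zero_add] at this
        have hqk1 := (smul_eq_zero.1 this).resolve_left hμ0
        refine absurd (hmin k (by omega) q ⟨hBq0, hqs, fun j hj => ?_⟩) hne
        rcases Nat.lt_or_eq_of_le (Nat.succ_le_of_lt hj) with h | rfl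
        · exact hqk j h
        · exact hqk1
      · simp only [map_add, map_sum, map_smul, ← hz0, ← hqs]
        simp
      · intro j
        simp only [map_add, map_sum, map_smul, hz, hqs, add_assoc]
      · intro j hj
        simp only [hzk j hj.le, zero_add]
        exact Finset.sum_eq_zero fun i _ => by rw [hqk _ (by omega), smul_zero]

end Blocks

/-! ### Existence of a block and induction on the dimension -/

section Decomposition

variable {K : Type*} [Field K] {V : Type*} [AddCommGroup V] [Module K V]

open LinearMap (BilinForm)

/-- Without polynomial solutions chains are linearly independent, so their length is bounded by the
dimension and a longest one exists. -/
theorem exists_jordan_splitsPair [FiniteDimensional K V] {A B : BilinForm K V} (hA : A.IsAlt)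
    (hB : B.IsAlt) (hnull : ∀ k q, IsNullChain A B k q → q = 0) {v : V} (hv : v ≠ 0)
    (hBv : B v = 0) :
    ∃ (n : ℕ) (_ : 1 ≤ n) (e : Fin n ⊕ Fin n → V) (ξ : Fin n ⊕ Fin n → Module.Dual K V),
      SplitsPair A B
        (Matrix.fromBlocks 0 (JKBlock.bidiagonal n n (1 : K) 0)
          (-(JKBlock.bidiagonal n n (1 : K) 0).transpose) 0)
        (Matrix.fromBlocks 0 (JKBlock.bidiagonal n n (0 : K) 1)
          (-(JKBlock.bidiagonal n n (0 : K) 1).transpose) 0) e ξ := by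
  classical
  by_contra! hcon
  have hall : ∀ n, ∃ q, IsJordanChain A B (n + 1) q := by
    intro n
    induction n with
    | zero => exact ⟨fun _ => v, hv, hBv, fun j hj => by omega⟩
    | succ n ih =>
      obtain ⟨q, hq⟩ := ih
      by_contra! hmax
      obtain ⟨e, ξ, h⟩ := hq.exists_splitsPair hA hB (by omega) hmax
      exact hcon _ (by omega) e ξ h
  obtain ⟨q, hq⟩ := hall (Module.finrank K V)
  have := hq.length_le_finrank hnull
  omega

theorem fromBlocks_bidiagonal_add_mul (n : ℕ) (lam : K) (x y : Fin n ⊕ Fin n) :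
    Matrix.fromBlocks 0 (JKBlock.bidiagonal n n (0 : K) 1)
        (-(JKBlock.bidiagonal n n (0 : K) 1).transpose) 0 x y +
      lam * Matrix.fromBlocks 0 (JKBlock.bidiagonal n n (1 : K) 0)
        (-(JKBlock.bidiagonal n n (1 : K) 0).transpose) 0 x y =
    Matrix.fromBlocks 0 (JKBlock.bidiagonal n n lam 1)
      (-(JKBlock.bidiagonal n n lam 1).transpose) 0 x y := by
  rcases x with i | i <;> rcases y with j | j <;>
    simp only [JKBlock.bidiagonal, Matrix.fromBlocks_apply₁₁,
      Matrix.fromBlocks_apply₁₂, Matrix.fromBlocks_apply₂₁, Matrix.fromBlocks_apply₂₂,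
      Matrix.neg_apply, Matrix.transpose_apply, Matrix.of_apply, Matrix.zero_apply] <;>
    (try split_ifs) <;> simp

theorem exists_block_splitsPair [IsAlgClosed K] [FiniteDimensional K V] [Nontrivial V]
    {A B : BilinForm K V} (hA : A.IsAlt) (hB : B.IsAlt) :
    ∃ (b : JKBlock K) (e : b.Index → V) (ξ : b.Index → Module.Dual K V),
      SplitsPair A B b.matA b.matB e ξ := by
  classical
  by_cases hker : LinearMap.ker B = ⊥
  · let E : V ≃ₗ[K] Module.Dual K V := LinearEquiv.ofInjectiveOfFinrankEq B
      (LinearMap.ker_eq_bot.1 hker) Subspace.dual_finrank_eq.symm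
    obtain ⟨lam, hlam⟩ := Module.End.exists_eigenvalue (E.symm.toLinearMap ∘ₗ A)
    obtain ⟨v, hv⟩ := hlam.exists_hasEigenvector
    have hAv : A v = lam • B v := by
      have := congr_arg E hv.apply_eq_smul
      rw [map_smul, LinearMap.comp_apply, LinearEquiv.coe_coe, E.apply_symm_apply] at this
      exact this
    have hCv : (A - lam • B) v = 0 := by simp [hAv]
    obtain ⟨n, hn, e, ξ, h⟩ := exists_jordan_splitsPair hB (hA.sub (hB.smul lam))
      -- A polynomial solution of (B, A - λB) vanishes from the top coefficient down, since `B` is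
      -- injective.
      (fun k q hq => by
        have hz : ∀ d j, k < j + d → q j = 0 := by
          intro d
          induction d with
          | zero => exact hq.2.2
          | succ d ih =>
            intro j hj
            refine LinearMap.ker_eq_bot'.1 hker _ ?_
            rw [hq.2.1, ih _ (by omega), map_zero]
        funext j
        exact hz (k + 1) j (by omega)) hv.2 hCv
    have hAC : ∀ u w, A u w = (A - lam • B) u w + lam * B u w := by simp
    refine ⟨.jordan n hn lam, e, ξ, h.dual, fun x y => (hAC _ _).trans ?_, h.gramA,
      fun w hw x => ?_⟩
    · exact (congr_arg₂ (fun s t => s + lam * t) (h.gramB x y) (h.gramA x y)).trans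
        (fromBlocks_bidiagonal_add_mul n lam x y)
    · obtain ⟨h1, h2⟩ := h.orth w hw x
      exact ⟨by rw [hAC, h1, h2]; simp, h1⟩
  · obtain ⟨v, hv, hv0⟩ := Submodule.exists_mem_ne_zero_of_ne_bot hker
    by_cases hnull : ∃ k q, IsNullChain A B k q ∧ q ≠ 0
    · obtain ⟨q, hq, hne⟩ := Nat.find_spec hnull
      obtain ⟨e, ξ, h⟩ := hq.exists_splitsPair hA hB hne fun k' hk' q' hq' => by
        by_contra h
        exact Nat.find_min hnull hk' ⟨q', hq', h⟩
      exact ⟨.kronecker _, e, ξ, h⟩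
    · push Not at hnull
      obtain ⟨n, hn, e, ξ, h⟩ := exists_jordan_splitsPair hA hB hnull hv0 hv
      exact ⟨.jordanInfty n hn, e, ξ, h⟩

/-- The vectors `e i x` are a basis in which the forms have the block matrices `blk i`. -/
structure IsJKBasis (A B : BilinForm K V) {m : ℕ} (blk : Fin m → JKBlock K)
    (e : ∀ i, (blk i).Index → V) : Prop where
  gramA : ∀ i x y, A (e i x) (e i y) = (blk i).matA x y
  gramB : ∀ i x y, B (e i x) (e i y) = (blk i).matB x y
  orth : ∀ i j, i ≠ j → ∀ x y, A (e i x) (e j y) = 0 ∧ B (e i x) (e j y) = 0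
  linearIndependent : ∀ c : ∀ i, (blk i).Index → K,
    ∑ i, ∑ x, c i x • e i x = 0 → ∀ i x, c i x = 0
  span : ∀ v, ∃ c : ∀ i, (blk i).Index → K, ∑ i, ∑ x, c i x • e i x = v

theorem SplitsPair.isJKBasis_cons {A B : BilinForm K V} (hA : A.IsAlt) (hB : B.IsAlt)
    {b : JKBlock K} {e : b.Index → V} {ξ : b.Index → Module.Dual K V}
    (h : SplitsPair A B b.matA b.matB e ξ) {W : Submodule K V}
    (hW : ∀ w, w ∈ W ↔ ∀ x, ξ x w = 0) {m : ℕ} {blk : Fin m → JKBlock K}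
    {f : ∀ i, (blk i).Index → W} (hf : IsJKBasis (A.restrict W) (B.restrict W) blk f) :
    IsJKBasis A B (Fin.cons b blk : Fin (m + 1) → JKBlock K)
      (Fin.cases e fun i x => (f i x : V)) := by
  have hξf : ∀ x i y, ξ x (f i y) = 0 := fun x i y => (hW _).1 (f i y).2 x
  have hfe : ∀ i x y, A (f i x) (e y) = 0 ∧ B (f i x) (e y) = 0 := fun i x y =>
    h.orth _ ((hW _).1 (f i x).2) y
  have hξe : ∀ (c : b.Index → K) x, ξ x (∑ y, c y • e y) = c x := fun c x => by
    simp only [map_sum, map_smul, h.dual, smul_eq_mul, mul_ite, mul_one, mul_zero,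
      Finset.sum_ite_eq, Finset.mem_univ, if_true]
  refine ⟨?_, ?_, ?_, ?_, ?_⟩
  · refine Fin.cases ?_ fun i => ?_
    · exact h.gramA
    · exact hf.gramA i
  · refine Fin.cases ?_ fun i => ?_
    · exact h.gramB
    · exact hf.gramB i
  · refine Fin.cases (Fin.cases ?_ fun j => ?_) fun i => Fin.cases ?_ fun j => ?_
    · exact fun h => absurd rfl h
    · intro _ x y
      obtain ⟨h1, h2⟩ := hfe j y x
      exact ⟨hA.isRefl.eq_zero h1, hB.isRefl.eq_zero h2⟩
    · exact fun _ => hfe i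
    · exact fun hij => hf.orth i j fun h => hij (congr_arg Fin.succ h)
  · intro c hc
    rw [Fin.sum_univ_succ] at hc
    have hc0 : ∀ x : b.Index, c 0 x = 0 := by
      intro x
      have := congr_arg (ξ x) hc
      rw [map_add, map_zero] at this
      have h0 : ξ x (∑ y : b.Index, c 0 y • e y) = c 0 x := hξe (c 0) x
      have h1 : ξ x (∑ i : Fin m, ∑ y : (blk i).Index, c i.succ y • (f i y : V)) = 0 := by
        simp [map_sum, hξf]
      have h2 : ξ x (∑ y : b.Index, c 0 y • e y) +
        ξ x (∑ i : Fin m, ∑ y : (blk i).Index, c i.succ y • (f i y : V)) = 0 := this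
      rwa [h0, h1, add_zero] at h2
    have hc' : ∑ i : Fin m, ∑ y : (blk i).Index, c i.succ y • f i y = 0 := by
      apply Subtype.ext
      have h0 : ∑ y : b.Index, c 0 y • e y = 0 := Finset.sum_eq_zero fun y _ => by
        rw [hc0, zero_smul]
      have h1 : ∑ y : b.Index, c 0 y • e y +
        ∑ i : Fin m, ∑ y : (blk i).Index, c i.succ y • (f i y : V) = 0 := hc
      rw [h0, zero_add] at h1
      simpa using h1
    refine Fin.cases ?_ fun i => ?_
    · exact hc0
    · exact hf.linearIndependent (fun i => c i.succ) hc' i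
  · intro v
    -- Subtracting its coordinates along `e` projects v to the common kernel of the ξ, the
    -- orthogonal complement treated by induction.
    have hw : v - ∑ x, ξ x v • e x ∈ W := by
      rw [hW]
      intro x
      rw [map_sub, hξe fun x => ξ x v, sub_self]
    obtain ⟨c, hc⟩ := hf.span ⟨_, hw⟩
    refine ⟨Fin.cases (fun x => ξ x v) c, ?_⟩
    rw [Fin.sum_univ_succ]
    have hc' : ∑ i : Fin m, ∑ y : (blk i).Index, c i y • (f i y : V) = v - ∑ x, ξ x v • e x := by
      simpa using congr_arg (Submodule.subtype W) hc
    change ∑ x : b.Index, ξ x v • e x +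
      ∑ i : Fin m, ∑ y : (blk i).Index, c i y • (f i y : V) = v
    rw [hc', add_sub_cancel]

theorem JKBlock.index_nonempty {K : Type*} (b : JKBlock K) : Nonempty b.Index := by
  cases b with
  | jordan n hn lam => exact ⟨Sum.inl ⟨0, hn⟩⟩
  | jordanInfty n hn => exact ⟨Sum.inl ⟨0, hn⟩⟩
  | kronecker k => exact ⟨Sum.inr ⟨0, Nat.succ_pos k⟩⟩

theorem exists_isJKBasis [IsAlgClosed K] {V : Type*} [AddCommGroup V] [Module K V]
    [FiniteDimensional K V] {A B : BilinForm K V} (hA : A.IsAlt) (hB : B.IsAlt) :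
    ∃ (m : ℕ) (blk : Fin m → JKBlock K) (e : ∀ i, (blk i).Index → V), IsJKBasis A B blk e := by
  induction hd : Module.finrank K V using Nat.strong_induction_on generalizing V with
  | _ d ih =>
    rcases subsingleton_or_nontrivial V with hV | hV
    · exact ⟨0, Fin.elim0, fun i => i.elim0, fun i => i.elim0, fun i => i.elim0,
        fun i => i.elim0, fun _ _ i => i.elim0, fun v => ⟨fun i => i.elim0, Subsingleton.elim _ _⟩⟩
    · obtain ⟨b, e, ξ, h⟩ := exists_block_splitsPair hA hB
      let W : Submodule K V := ⨅ x, LinearMap.ker (ξ x)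
      have hW : ∀ w, w ∈ W ↔ ∀ x, ξ x w = 0 := fun w => by simp [W]
      have hlt : Module.finrank K W < d := by
        obtain ⟨x⟩ := b.index_nonempty
        rw [← hd]
        refine Submodule.finrank_lt fun htop => ?_
        have := (hW (e x)).1 (htop ▸ Submodule.mem_top) x
        simp [h.dual] at this
      obtain ⟨m, blk, f, hf⟩ := ih _ hlt (A := A.restrict W) (B := B.restrict W)
        (fun w => hA w) (fun w => hB w) rfl
      exact ⟨_, _, _, h.isJKBasis_cons hA hB hW hf⟩

theorem IsJKBasis.exists_basis {A B : BilinForm K V} {m : ℕ} {blk : Fin m → JKBlock K}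
    {e : ∀ i, (blk i).Index → V} (h : IsJKBasis A B blk e) :
    ∃ b : Module.Basis (Σ i : Fin m, (blk i).Index) K V,
      LinearMap.BilinForm.toMatrix b A = Matrix.blockDiagonal' (fun i => (blk i).matA) ∧
      LinearMap.BilinForm.toMatrix b B = Matrix.blockDiagonal' (fun i => (blk i).matB) := by
  let g : (Σ i : Fin m, (blk i).Index) → V := fun x => e x.1 x.2
  have hli : LinearIndependent K g := by
    rw [Fintype.linearIndependent_iff]
    intro c hc x
    rw [Fintype.sum_sigma] at hc
    exact h.linearIndependent (fun i y => c ⟨i, y⟩) hc x.1 x.2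
  have hsp : ⊤ ≤ Submodule.span K (Set.range g) := by
    intro v _
    obtain ⟨c, rfl⟩ := h.span v
    exact Submodule.sum_mem _ fun i _ => Submodule.sum_mem _ fun x _ =>
      Submodule.smul_mem _ _ (Submodule.subset_span ⟨⟨i, x⟩, rfl⟩)
  refine ⟨Module.Basis.mk hli hsp, ?_, ?_⟩
  · ext ⟨i, x⟩ ⟨j, y⟩
    rw [LinearMap.BilinForm.toMatrix_apply, Module.Basis.mk_apply, Module.Basis.mk_apply]
    rcases eq_or_ne i j with rfl | hij
    · rw [Matrix.blockDiagonal'_apply_eq]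
      exact h.gramA i x y
    · rw [Matrix.blockDiagonal'_apply_ne _ _ _ hij]
      exact (h.orth i j hij x y).1
  · ext ⟨i, x⟩ ⟨j, y⟩
    rw [LinearMap.BilinForm.toMatrix_apply, Module.Basis.mk_apply, Module.Basis.mk_apply]
    rcases eq_or_ne i j with rfl | hij
    · rw [Matrix.blockDiagonal'_apply_eq]
      exact h.gramB i x y
    · rw [Matrix.blockDiagonal'_apply_ne _ _ _ hij]
      exact (h.orth i j hij x y).2

theorem isAlt_of_ringChar_ne_two (hK : ringChar K ≠ 2) {A : BilinForm K V}
    (hA : ∀ u v, A u v = -A v u) : A.IsAlt := fun v =>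
  (Ring.eq_self_iff_eq_zero_of_char_ne_two hK).1 (hA v v).symm

end Decomposition

theorem theorem1 {K : Type*} [Field K] [IsAlgClosed K] (hK : ringChar K ≠ 2)
    {V : Type*} [AddCommGroup V] [Module K V] [FiniteDimensional K V]
    (A B : LinearMap.BilinForm K V)
    (hA : ∀ u v : V, A u v = -A v u) (hB : ∀ u v : V, B u v = -B v u) :
    ∃ (m : ℕ) (blk : Fin m → JKBlock K)
      (e : Module.Basis (Σ i : Fin m, (blk i).Index) K V),
      LinearMap.BilinForm.toMatrix e A = Matrix.blockDiagonal' (fun i => (blk i).matA) ∧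
      LinearMap.BilinForm.toMatrix e B = Matrix.blockDiagonal' (fun i => (blk i).matB) := by
  obtain ⟨m, blk, e, h⟩ := exists_isJKBasis (isAlt_of_ringChar_ne_two hK hA)
    (isAlt_of_ringChar_ne_two hK hB)
  exact ⟨m, blk, h.exists_basis⟩
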